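/- Let $k$ be a field of characteristic zero, let $Y=\begin{bmatrix} a_1 & a_2\\ b_1 & b_2\end{bmatrix}$ be a $2\times 2$ matrix of indeterminates, and let $k[Y]=k[a_1,a_2,b_1,b_2]$. Let $\mathrm{SL}_2(k)$ act on $k[Y]$ by $k$-algebra automorphisms, where $M\in \mathrm{SL}_2(k)$ acts by $Y\mapsto MY$, i.e. each entry $[Y]_{ij}$ is sent to $[MY]_{ij}$. Put $\Delta_{i,j}:=a_ib_j-a_jb_i$. A Reynolds operator for this action is a $k$-linear map $\mathcal R\colon k[Y]\to k[Y]^{\mathrm{SL}_2(k)}$ such that $\mathcal R(r)=r$ for every invariant $r$ and $\mathcal R(M(f))=\mathcal R(f)$ for all $M\in\mathrm{SL}_2(k)$ and $f\in k[Y]$. Then $k[Y]^{\mathrm{SL}_2(k)}=k[\{\Delta\}]$, the $k$-subalgebra generated by the size $2$ minors $\Delta_{i,j}$ of $Y$, there is exactly one Reynolds operator $\mathcal R\colon k[Y]\to k[\{\Delta\}]$, and for every monomial $\mu$ in $a_1,a_2,b_1,b_2$ (with coefficient $1$) it satisfies the following. (a) If $\mu=(a_1b_2)^n(a_2b_1)^m$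 for some integers $n,m\ge 0$, then $$\mathcal R(\mu)=\mathcal R\bigl((a_1b_2)^n(a_2b_1)^m\bigr)=\frac{n!\,m!}{(n+m+1)!}\,\Delta_{1,2}^{\,n}\,\Delta_{2,1}^{\,m};$$ in particular, $\mathcal R\bigl((a_1b_2)^n\bigr)=\dfrac{1}{n+1}\,\Delta_{1,2}^{\,n}$ for every $n\ge 0$. (b) If $\mu$ is not of the form $(a_1b_2)^n(a_2b_1)^m$ with $n,m\ge 0$, then $\mathcal R(\mu)=0$. -/

import Mathlib

open MvPolynomial

noncomputable section

namespace ReynoldsSL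

/-- The polynomial ring `k[Y]` in the entries `y i j` of a generic `t × n` matrix `Y`. -/
abbrev Poly (k : Type*) [Field k] (t n : ℕ) : Type _ := MvPolynomial (Fin t × Fin n) k

/-- The `k`-algebra endomorphism of `k[Y]` by which `M ∈ SL_t(k)` acts: `Y ↦ M Y`, that is, the
variable `y i j` is sent to the `(i, j)` entry of `M Y`. -/
def act {k : Type*} [Field k] {t : ℕ} (n : ℕ) (M : Matrix.SpecialLinearGroup (Fin t) k) :
    Poly k t n →ₐ[k] Poly k t n :=
  aeval fun p =>
    (M.1.map (fun c => (C c : Poly k t n)) * Matrix.mvPolynomialX (Fin t) (Fin n) k :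
      Matrix (Fin t) (Fin n) (Poly k t n)) p.1 p.2

/-- The ring of invariants `k[Y]^{SL_t(k)}`. -/
def invariants (k : Type*) [Field k] (t n : ℕ) : Subalgebra k (Poly k t n) where
  carrier := {f | ∀ M : Matrix.SpecialLinearGroup (Fin t) k, act n M f = f}
  mul_mem' hf hg M := by rw [map_mul, hf M, hg M]
  add_mem' hf hg M := by rw [map_add, hf M, hg M]
  algebraMap_mem' r M := (act n M).commutes r

/-- A Reynolds operator for the action of `SL_t(k)` on `k[Y]`: a `k`-linear map
`k[Y] → k[Y]^{SL_t(k)}` which restricts to the identity on invariants and takes the same value on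
`f` and on `M f`, for every `M ∈ SL_t(k)`. -/
structure IsReynolds {k : Type*} [Field k] {t n : ℕ}
    (R : Poly k t n →ₗ[k] invariants k t n) : Prop where
  splits : ∀ r : invariants k t n, R (r : Poly k t n) = r
  equivariant : ∀ (M : Matrix.SpecialLinearGroup (Fin t) k) (f : Poly k t n),
    R (act n M f) = R f

/-- The entries `a i` of the first row of the generic `2 × N` matrix (`i` starts at `0`). -/
def a (k : Type*) [Field k] {N : ℕ} (i : Fin N) : Poly k 2 N := X (0, i)

/-- The entries `b i` of the second row of the generic `2 × N` matrix (`i` starts at `0`). -/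
def b (k : Type*) [Field k] {N : ℕ} (i : Fin N) : Poly k 2 N := X (1, i)

/-- The minor `Δ i j = a i * b j - a j * b i`. -/
def Δ (k : Type*) [Field k] {N : ℕ} (i j : Fin N) : Poly k 2 N :=
  a k i * b k j - a k j * b k i

end ReynoldsSL

end

noncomputable section

namespace ReynoldsSL

variable {k : Type*} [Field k]

/-! A matrix of determinant `d ≠ 0` is an `SL₂`-translate of `diag(1, d)`, so away from `Δ = 0` an
invariant is a polynomial in `Δ` (`exists_aeval_delta`).

Existence: Cayley's operator Ω commutes with the action (`omega_act`) and Ω^d Δ^d is a nonzero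
constant, so `f ↦ (Ω^d f)(0) Δ^d`, normalized, is a Reynolds operator in degree `2d`.

Uniqueness and values: invariance under unipotent matrices, differentiated at the identity, shows
that any Reynolds operator kills the image of `b₁ ∂/∂a₁ + b₂ ∂/∂a₂` (`relation`). With one diagonal
matrix this kills every monomial not of the form `(a₁b₂)^n (a₂b₁)^m` and reduces the others to
`(a₁b₂)^(n+m)`. Fixing `Δ^(n+m)` determines the remaining scalar. -/

lemma act_X {t n : ℕ} (M : Matrix.SpecialLinearGroup (Fin t) k) (p : Fin t × Fin n) :
    act n M (X p) = ∑ r, C (M.1 p.1 r) * X (r, p.2) := by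
  simp [act, Matrix.mul_apply]

lemma act_X_two {n : ℕ} (M : Matrix.SpecialLinearGroup (Fin 2) k) (r : Fin 2) (j : Fin n) :
    act n M (X (r, j)) = C (M.1 r 0) * X (0, j) + C (M.1 r 1) * X (1, j) := by
  simp [act_X, Fin.sum_univ_two]

lemma eval_act {t n : ℕ} (M : Matrix.SpecialLinearGroup (Fin t) k) (y : Matrix (Fin t) (Fin n) k)
    (f : Poly k t n) :
    eval (fun p => y p.1 p.2) (act n M f) = eval (fun p => (M.1 * y) p.1 p.2) f := by
  induction f using MvPolynomial.induction_on with
  | C c => simp [act]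
  | add f g hf hg => simp [hf, hg]
  | mul_X f p hf => simp [hf, act_X, Matrix.mul_apply]

/-- The matrix `y` with nonzero determinant `d` is `SL₂`-equivalent to `diag(1, d)`. -/
lemma exists_mul_diag (y : Matrix (Fin 2) (Fin 2) k) (hy : y.det ≠ 0) :
    ∃ M : Matrix.SpecialLinearGroup (Fin 2) k, M.1 * !![1, 0; 0, y.det] = y := by
  refine ⟨⟨!![y 0 0, y 0 1 / y.det; y 1 0, y 1 1 / y.det], ?_⟩, ?_⟩
  · rw [Matrix.det_fin_two_of]
    rw [Matrix.det_fin_two] at hy ⊢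
    field_simp
  · ext i j
    fin_cases i <;> fin_cases j <;> simp [hy]

lemma eval_delta (y : Matrix (Fin 2) (Fin 2) k) :
    eval (fun p => y p.1 p.2) (Δ k 0 1) = y.det := by
  simp [Δ, a, b, Matrix.det_fin_two]

lemma delta_mem_invariants (i j : Fin 2) : Δ k i j ∈ invariants k 2 2 := by
  intro M
  have hM := M.2
  rw [Matrix.det_fin_two] at hM
  have hC := congrArg (C (σ := Fin 2 × Fin 2)) hM
  simp only [map_sub, map_mul, map_one] at hC
  simp only [Δ, a, b, map_sub, map_mul, act_X_two]
  linear_combination (X (0, i) * X (1, j) - X (0, j) * X (1, i)) * hC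

lemma delta_zero_one_ne_zero : Δ k 0 1 ≠ (0 : Poly k 2 2) := by
  intro h
  simpa [h] using eval_delta (1 : Matrix (Fin 2) (Fin 2) k)

/-- Every invariant is a polynomial in the minor `Δ 0 1`. -/
lemma exists_aeval_delta [Infinite k] {f : Poly k 2 2} (hf : f ∈ invariants k 2 2) :
    ∃ p : Polynomial k, f = Polynomial.aeval (Δ k 0 1) p := by
  -- The restriction of `f` to the slice `diag(1, T)`.
  let p : Polynomial k := aeval
    (fun q : Fin 2 × Fin 2 => (!![1, 0; 0, Polynomial.X] : Matrix _ _ (Polynomial k)) q.1 q.2) f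
  have hp (d : k) : p.eval d = eval (fun q => (!![1, 0; 0, d] : Matrix _ _ k) q.1 q.2) f := by
    have h : (Polynomial.aeval d).comp (aeval
        (fun q : Fin 2 × Fin 2 => (!![1, 0; 0, Polynomial.X] : Matrix _ _ (Polynomial k)) q.1 q.2))
        = aeval (fun q : Fin 2 × Fin 2 => (!![1, 0; 0, d] : Matrix _ _ k) q.1 q.2) := by
      ext ⟨i, j⟩
      fin_cases i <;> fin_cases j <;> simp
    have h' := DFunLike.congr_fun h f
    rw [AlgHom.comp_apply] at h'
    rw [← Polynomial.coe_aeval_eq_eval, h']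
    rfl
  refine ⟨p, ?_⟩
  -- The factor `Δ` makes singular matrices harmless; it is cancelled at the end in the domain
  -- `k[Y]`.
  have key : (f - Polynomial.aeval (Δ k 0 1) p) * Δ k 0 1 = 0 := by
    refine MvPolynomial.funext fun v => ?_
    let y : Matrix (Fin 2) (Fin 2) k := fun i j => v (i, j)
    have hv : v = fun q => y q.1 q.2 := rfl
    rw [hv, map_mul, eval_delta, map_zero]
    by_cases hy : y.det = 0
    · rw [hy, mul_zero]
    obtain ⟨M, hM⟩ := exists_mul_diag y hy
    have h1 : eval (fun q => y q.1 q.2) f = p.eval y.det := by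
      have h := eval_act M !![1, 0; 0, y.det] f
      rw [hf M, hM] at h
      rw [hp, h]
    have h2 : eval (fun q => y q.1 q.2) (Polynomial.aeval (Δ k 0 1) p) = p.eval y.det := by
      have := Polynomial.aeval_algHom_apply (aeval (R := k) fun q : Fin 2 × Fin 2 => y q.1 q.2)
        (Δ k 0 1) p
      rw [MvPolynomial.aeval_eq_eval] at this
      rw [← eval_delta y, ← Polynomial.coe_aeval_eq_eval]
      exact this.symm
    rw [map_sub, h1, h2, sub_self, zero_mul]
  exact sub_eq_zero.1 ((mul_eq_zero.1 key).resolve_right delta_zero_one_ne_zero)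

theorem invariants_eq_adjoin [Infinite k] :
    invariants k 2 2 = Algebra.adjoin k {f | ∃ i j : Fin 2, f = Δ k i j} := by
  refine le_antisymm (fun f hf => ?_) (Algebra.adjoin_le ?_)
  · obtain ⟨p, rfl⟩ := exists_aeval_delta hf
    exact Algebra.adjoin_mono (Set.singleton_subset_iff.2 (Set.mem_ofPred.2 ⟨0, 1, rfl⟩))
      (Polynomial.aeval_mem_adjoin_singleton k _)
  · rintro _ ⟨i, j, rfl⟩
    exact delta_mem_invariants i j

/-! ### The Omega process -/

/-- Chain rule: each column of partial derivatives transforms by the transpose of `M`. -/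
lemma pderiv_act {t n : ℕ} (M : Matrix.SpecialLinearGroup (Fin t) k) (p : Fin t) (j : Fin n)
    (f : Poly k t n) :
    pderiv (p, j) (act n M f) = ∑ r, C (M.1 r p) * act n M (pderiv (r, j) f) := by
  induction f using MvPolynomial.induction_on with
  | C c => simp [act]
  | add f g hf hg => simp [hf, hg, mul_add, Finset.sum_add_distrib]
  | mul_X f q hf =>
    obtain ⟨q, l⟩ := q
    have hX : pderiv (p, j) (act n M (X (q, l))) = if j = l then C (M.1 q p) else 0 := by
      rw [act_X, map_sum]
      split_ifs with h
      · subst h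
        rw [Finset.sum_eq_single p]
        · simp
        · intro r _ hr
          simp [hr]
        · simp
      · refine Finset.sum_eq_zero fun r _ => ?_
        have : (r, l) ≠ (p, j) := by simp [Ne.symm h]
        simp [pderiv_X_of_ne this]
    have hs (r : Fin t) : pderiv (r, j) (X (q, l) : Poly k t n)
        = if r = q then if j = l then 1 else 0 else 0 := by
      simp only [pderiv_X, Pi.single_apply, Prod.mk.injEq, eq_comm (a := q), eq_comm (a := l)]
      by_cases h1 : r = q <;> by_cases h2 : j = l <;> simp [h1, h2]
    simp only [map_mul, pderiv_mul, hf, hX, hs, map_add, mul_add, Finset.sum_add_distrib,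
      Finset.sum_mul]
    congr 1
    · exact Finset.sum_congr rfl fun r _ => by ring
    · rw [Finset.sum_eq_single q]
      · rw [if_pos rfl]
        split_ifs <;> simp [mul_comm]
      · intro r _ hr
        simp [hr]
      · simp

/-- Cayley's Omega operator `∂²/∂a₁∂b₂ - ∂²/∂a₂∂b₁`. -/
def omega (k : Type*) [Field k] : Poly k 2 2 →ₗ[k] Poly k 2 2 :=
  (pderiv (0, 0)).toLinearMap ∘ₗ (pderiv (1, 1)).toLinearMap -
    (pderiv (0, 1)).toLinearMap ∘ₗ (pderiv (1, 0)).toLinearMap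

lemma omega_apply (f : Poly k 2 2) :
    omega k f = pderiv (0, 0) (pderiv (1, 1) f) - pderiv (0, 1) (pderiv (1, 0) f) := rfl

lemma pderiv_comm' {σ : Type*} (i j : σ) (f : MvPolynomial σ k) :
    pderiv i (pderiv j f) = pderiv j (pderiv i f) := by
  have h : ⁅pderiv (R := k) i, pderiv j⁆ = (0 : Derivation k (MvPolynomial σ k) (MvPolynomial σ k)) := by
    classical
    refine MvPolynomial.derivation_ext fun l => ?_
    rw [Derivation.commutator_apply]
    simp only [pderiv_X, Pi.single_apply]
    split_ifs <;> simp
  have := DFunLike.congr_fun h f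
  rw [Derivation.commutator_apply] at this
  exact sub_eq_zero.1 this

/-- Ω is the determinant of the matrix of partial derivatives, so the action changes it by the
factor `det M = 1`. -/
lemma omega_act (M : Matrix.SpecialLinearGroup (Fin 2) k) (f : Poly k 2 2) :
    omega k (act 2 M f) = act 2 M (omega k f) := by
  have hM := M.2
  rw [Matrix.det_fin_two] at hM
  have hC := congrArg (C (σ := Fin 2 × Fin 2)) hM
  simp only [map_sub, map_mul, map_one] at hC
  simp only [omega_apply, pderiv_act, Fin.sum_univ_two, map_add, map_sub, pderiv_C_mul]
  have hp (p q : Fin 2 × Fin 2) := pderiv_comm' p q f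
  rw [hp (0, 1) (0, 0), hp (1, 1) (0, 0), hp (1, 0) (0, 1), hp (1, 1) (1, 0)]
  linear_combination (act 2 M ((pderiv (0, 0)) ((pderiv (1, 1)) f)) -
    act 2 M ((pderiv (0, 1)) ((pderiv (1, 0)) f))) * hC

lemma omega_delta_pow (e : ℕ) :
    omega k (Δ k 0 1 ^ (e + 1)) = (((e + 1) * (e + 2) : ℕ) : k) • Δ k 0 1 ^ e := by
  have h00 : pderiv (0, 0) (Δ k 0 1) = (X (1, 1) : Poly k 2 2) := by
    simp [Δ, a, b, pderiv_X]
  have h01 : pderiv (0, 1) (Δ k 0 1) = (-X (1, 0) : Poly k 2 2) := by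
    simp [Δ, a, b, pderiv_X]
  have h10 : pderiv (1, 0) (Δ k 0 1) = (-X (0, 1) : Poly k 2 2) := by
    simp [Δ, a, b, pderiv_X]
  have h11 : pderiv (1, 1) (Δ k 0 1) = (X (0, 0) : Poly k 2 2) := by
    simp [Δ, a, b, pderiv_X]
  have hΔ : Δ k 0 1 = (X (0, 0) * X (1, 1) - X (0, 1) * X (1, 0) : Poly k 2 2) := rfl
  rw [omega_apply, smul_eq_C_mul, pderiv_pow, pderiv_pow, h11, h10]
  -- The second differentiation produces the exponent `e - 1`, truncated when `e = 0`.
  rcases e with _ | e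
  · have h2 : (2 : Poly k 2 2) = C 2 := (map_ofNat C 2).symm
    simp [← h2, one_add_one_eq_two]
  · simp only [Nat.add_sub_cancel, pderiv_mul, pderiv_pow, h00, h01, map_natCast, map_neg,
      Derivation.map_natCast, pderiv_X_self]
    push_cast
    rw [pow_succ (Δ k 0 1) e, hΔ]
    ring

lemma constantCoeff_omega_pow_delta (d : ℕ) :
    constantCoeff ((omega k ^ d) (Δ k 0 1 ^ d)) = (d.factorial : k) * ((d + 1).factorial : k) := by
  induction d with
  | zero => simp
  | succ d ih =>
    rw [pow_succ, Module.End.mul_apply, omega_delta_pow, map_smul, smul_eq_C_mul, map_mul, ih,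
      constantCoeff_C, Nat.factorial_succ (d + 1), Nat.factorial_succ d]
    push_cast
    ring

lemma omega_pow_act (M : Matrix.SpecialLinearGroup (Fin 2) k) (d : ℕ) (f : Poly k 2 2) :
    (omega k ^ d) (act 2 M f) = act 2 M ((omega k ^ d) f) := by
  induction d generalizing f with
  | zero => simp
  | succ d ih => simp only [pow_succ, Module.End.mul_apply, omega_act, ih]

lemma constantCoeff_act {t n : ℕ} (M : Matrix.SpecialLinearGroup (Fin t) k) (f : Poly k t n) :
    constantCoeff (act n M f) = constantCoeff f := by
  induction f using MvPolynomial.induction_on with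
  | C c => simp [act]
  | add f g hf hg => simp [hf, hg]
  | mul_X f p hf => simp [act_X]

lemma isHomogeneous_act {t n d : ℕ} (M : Matrix.SpecialLinearGroup (Fin t) k) {f : Poly k t n}
    (hf : f.IsHomogeneous d) : (act n M f).IsHomogeneous d := by
  have := hf.aeval (n := 1) (fun p : Fin t × Fin n => act n M (X p)) fun p => by
    rw [act_X]
    exact IsHomogeneous.sum _ _ _ fun r _ => by
      simpa using (isHomogeneous_C _ _).mul (isHomogeneous_X k (r, p.2))
  simpa [act] using this

lemma isHomogeneous_delta : (Δ k 0 1 : Poly k 2 2).IsHomogeneous 2 :=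
  ((isHomogeneous_X k _).mul (isHomogeneous_X k _)).sub
    ((isHomogeneous_X k _).mul (isHomogeneous_X k _))

/-- `Δ^d` scaled by the normalized value at the origin of `Ω^d f`. -/
def omegaProjection (k : Type*) [Field k] (d : ℕ) : Poly k 2 2 →ₗ[k] invariants k 2 2 :=
  LinearMap.smulRight
    ((((d.factorial : k) * ((d + 1).factorial : k))⁻¹) •
      ((aeval (R := k) (0 : Fin 2 × Fin 2 → k)).toLinearMap ∘ₗ omega k ^ d))
    ((⟨Δ k 0 1, delta_mem_invariants 0 1⟩ : invariants k 2 2) ^ d)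

lemma omegaProjection_act (M : Matrix.SpecialLinearGroup (Fin 2) k) (d : ℕ) (f : Poly k 2 2) :
    omegaProjection k d (act 2 M f) = omegaProjection k d f := by
  simp [omegaProjection, omega_pow_act, constantCoeff_act]

lemma coe_omegaProjection_delta [CharZero k] (d : ℕ) :
    (omegaProjection k d (Δ k 0 1 ^ d) : Poly k 2 2) = Δ k 0 1 ^ d := by
  have h1 : (d.factorial : k) ≠ 0 := by exact_mod_cast d.factorial_ne_zero
  have h2 : ((d + 1).factorial : k) ≠ 0 := by exact_mod_cast (d + 1).factorial_ne_zero
  simp only [omegaProjection]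
  simp [constantCoeff_omega_pow_delta]
  field_simp
  simp

/-- The Reynolds operator, given by the Omega process in each degree. -/
def reynolds (k : Type*) [Field k] : Poly k 2 2 →ₗ[k] invariants k 2 2 :=
  (basisMonomials _ k).constr k fun s => omegaProjection k (s.degree / 2) (monomial s 1)

/-- Needed because `M` sends a monomial to a form, not to a monomial. The rounding in `n / 2` is
harmless: for odd `n` the power of Ω leaves a linear form, which vanishes at the origin. -/
lemma reynolds_of_isHomogeneous {f : Poly k 2 2} {n : ℕ} (hf : f.IsHomogeneous n) :
    reynolds k f = omegaProjection k (n / 2) f := by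
  rw [f.as_sum, map_sum, map_sum]
  refine Finset.sum_congr rfl fun s hs => ?_
  have hs : s.degree = n := by
    rw [Finsupp.degree_eq_weight_one]; exact hf (mem_support_iff.1 hs)
  have h1 : monomial s (coeff s f) = coeff s f • monomial s (1 : k) := by
    rw [smul_monomial, smul_eq_mul, mul_one]
  have h2 := (basisMonomials (Fin 2 × Fin 2) k).constr_basis k
    (fun s => omegaProjection k (s.degree / 2) (monomial s 1)) s
  rw [coe_basisMonomials] at h2
  rw [h1, map_smul, map_smul, reynolds, h2, hs]

theorem isReynolds_reynolds [CharZero k] : IsReynolds (reynolds k) where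
  splits r := by
    obtain ⟨f, hf⟩ := r
    obtain ⟨p, rfl⟩ := exists_aeval_delta hf
    refine Subtype.ext ?_
    show ((reynolds k) (Polynomial.aeval (Δ k 0 1) p) : Poly k 2 2) = Polynomial.aeval (Δ k 0 1) p
    rw [Polynomial.aeval_eq_sum_range, map_sum, AddSubmonoidClass.coe_finsetSum]
    refine Finset.sum_congr rfl fun d _ => ?_
    have h := reynolds_of_isHomogeneous ((isHomogeneous_delta (k := k)).pow d)
    rw [Nat.mul_div_cancel_left d two_pos] at h
    rw [map_smul, h, Subalgebra.coe_smul, coe_omegaProjection_delta]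
  equivariant M f := by
    induction f using MvPolynomial.induction_on' with
    | add f g hf hg => simp [hf, hg]
    | monomial s c =>
      have h : (monomial s c : Poly k 2 2).IsHomogeneous s.degree := isHomogeneous_monomial c rfl
      rw [reynolds_of_isHomogeneous h, reynolds_of_isHomogeneous (isHomogeneous_act M h),
        omegaProjection_act]

/-! ### Uniqueness and the values on monomials -/

/-- The monomial `a₁^i a₂^j b₁^p b₂^q`. -/
def mon (k : Type*) [Field k] (i j p q : ℕ) : Poly k 2 2 :=
  X (0, 0) ^ i * X (0, 1) ^ j * X (1, 0) ^ p * X (1, 1) ^ q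

lemma monomial_eq_mon (s : Fin 2 × Fin 2 →₀ ℕ) :
    monomial s (1 : k) = mon k (s (0, 0)) (s (0, 1)) (s (1, 0)) (s (1, 1)) := by
  rw [monomial_eq, Finsupp.prod_fintype _ _ (fun _ => pow_zero _)]
  simp [Fintype.prod_prod_type, Fin.prod_univ_two, mon, mul_assoc]

lemma mon_eq_mul_pow (n m : ℕ) :
    mon k n m m n = (a k 0 * b k 1) ^ n * (a k 1 * b k 0) ^ m := by
  simp only [mon, a, b]
  ring

/-- The generic translate of `f` by the unipotent matrices `!![1, T; 0, 1]`. -/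
def unipotentOrbit (k : Type*) [Field k] : Poly k 2 2 →ₐ[k] Polynomial (Poly k 2 2) :=
  aeval fun p => if p.1 = 0 then Polynomial.C (X p) + Polynomial.X * Polynomial.C (X (1, p.2))
    else Polynomial.C (X p)

def unipotent (c : k) : Matrix.SpecialLinearGroup (Fin 2) k :=
  ⟨!![1, c; 0, 1], by simp⟩

lemma eval_unipotentOrbit (c : k) (f : Poly k 2 2) :
    (unipotentOrbit k f).eval (C c) = act 2 (unipotent c) f := by
  induction f using MvPolynomial.induction_on with
  | C r => simp [act, unipotentOrbit, algebraMap_eq]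
  | add f g hf hg => simp [hf, hg]
  | mul_X f p hf =>
    obtain ⟨i, j⟩ := p
    rw [map_mul, map_mul, Polynomial.eval_mul, hf, act_X_two]
    fin_cases i <;> simp [unipotentOrbit, unipotent, mul_comm (C c)]

/-- A linear map which takes one value on the points `F(c)`, `c ∈ k`, of a curve kills the
derivative of `F` at `0`. -/
lemma map_coeff_one_eq_zero [Infinite k] {A : Type*} [CommRing A] [Algebra k A] {V : Type*}
    [AddCommGroup V] [Module k V] (R : A →ₗ[k] V) (F : Polynomial A) (v : V)
    (h : ∀ c : k, R (F.eval (algebraMap k A c)) = v) : R (F.coeff 1) = 0 := by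
  by_contra hne
  obtain ⟨φ, hφ⟩ := Module.Projective.exists_dual_ne_zero k hne
  -- `G(c) = φ(R(F(c)))` is constant in `c`, so its linear coefficient vanishes. The bound
  -- `natDegree + 2` keeps index 1 in range.
  let G : Polynomial k :=
    ∑ n ∈ Finset.range (F.natDegree + 2), Polynomial.monomial n (φ (R (F.coeff n)))
  have hG : G = Polynomial.C (φ v) := by
    refine Polynomial.funext fun c => ?_
    rw [Polynomial.eval_C, ← h c, Polynomial.eval_eq_sum_range' (p := F) (n := F.natDegree + 2) (by omega),
      map_sum, map_sum, Polynomial.eval_finsetSum]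
    refine Finset.sum_congr rfl fun n _ => ?_
    rw [Polynomial.eval_monomial, ← map_pow, mul_comm (F.coeff n), ← Algebra.smul_def, map_smul,
      map_smul, smul_eq_mul, mul_comm]
  refine hφ ?_
  have h1 := congrArg (Polynomial.coeff · 1) hG
  simpa [G, Polynomial.coeff_monomial, Polynomial.coeff_C] using h1

lemma map_unipotent [Infinite k] {R : Poly k 2 2 →ₗ[k] invariants k 2 2} (hR : IsReynolds R)
    (f : Poly k 2 2) : R ((unipotentOrbit k f).coeff 1) = 0 :=
  map_coeff_one_eq_zero R _ (R f) fun c => by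
    rw [algebraMap_eq, eval_unipotentOrbit, hR.equivariant]

/-- This is the derivation `b₁ ∂/∂a₁ + b₂ ∂/∂a₂` on a monomial. A truncated exponent occurs only
with coefficient zero. -/
lemma coeff_one_unipotentOrbit_mon (i j p q : ℕ) :
    (unipotentOrbit k (mon k i j p q)).coeff 1 =
      (i : k) • mon k (i - 1) j (p + 1) q + (j : k) • mon k i (j - 1) p (q + 1) := by
  have h (F : Polynomial (Poly k 2 2)) : F.coeff 1 = F.derivative.eval 0 := by
    rw [← Polynomial.coeff_zero_eq_eval_zero, Polynomial.coeff_derivative]; simp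
  rw [h]
  simp [unipotentOrbit, mon, Polynomial.derivative_pow, smul_eq_C_mul]
  ring

/-! ### Values of a Reynolds operator forced by equivariance -/

section Relations

variable [CharZero k] {R : Poly k 2 2 →ₗ[k] invariants k 2 2} (hR : IsReynolds R)
include hR

lemma relation (i j p q : ℕ) :
    (i : k) • R (mon k (i - 1) j (p + 1) q) + (j : k) • R (mon k i (j - 1) p (q + 1)) = 0 := by
  rw [← map_smul, ← map_smul, ← map_add, ← coeff_one_unipotentOrbit_mon, map_unipotent hR]

/-- Each relation trades a factor `a₁b₂` for `a₂b₁`; the exponent of `a₁` runs out first, and there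
the relation has a single term. -/
lemma map_mon_eq_zero_of_lt_right {i j p q : ℕ} (h : i < q) : R (mon k i j p q) = 0 := by
  induction i generalizing j p q with
  | zero =>
    obtain ⟨q, rfl⟩ := Nat.exists_eq_succ_of_ne_zero h.ne'
    have := relation hR 0 (j + 1) p q
    simpa [Nat.cast_add_one_ne_zero] using this
  | succ i ih =>
    obtain ⟨q, rfl⟩ := Nat.exists_eq_succ_of_ne_zero (Nat.ne_zero_of_lt h)
    have := relation hR (i + 1) (j + 1) p q
    rw [Nat.add_sub_cancel, ih (by omega), smul_zero, zero_add] at this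
    exact (smul_eq_zero.1 this).resolve_left (Nat.cast_ne_zero.2 j.succ_ne_zero)

lemma map_mon_eq_zero_of_lt_left {i j p q : ℕ} (h : j < p) : R (mon k i j p q) = 0 := by
  induction j generalizing i p q with
  | zero =>
    obtain ⟨p, rfl⟩ := Nat.exists_eq_succ_of_ne_zero h.ne'
    have := relation hR (i + 1) 0 p q
    simpa [Nat.cast_add_one_ne_zero] using this
  | succ j ih =>
    obtain ⟨p, rfl⟩ := Nat.exists_eq_succ_of_ne_zero (Nat.ne_zero_of_lt h)
    have := relation hR (i + 1) (j + 1) p q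
    rw [Nat.add_sub_cancel, Nat.add_sub_cancel, ih (by omega), smul_zero, add_zero] at this
    exact (smul_eq_zero.1 this).resolve_left (Nat.cast_ne_zero.2 i.succ_ne_zero)

lemma map_mon_eq_zero_of_unbalanced {i j p q : ℕ} (h : i + j ≠ p + q) :
    R (mon k i j p q) = 0 := by
  have h2 : (2 : k) ≠ 0 := two_ne_zero
  let M : Matrix.SpecialLinearGroup (Fin 2) k := ⟨!![2, 0; 0, 2⁻¹], by simp⟩
  -- `diag(2, 1/2)` scales the monomial by `2^(i+j-p-q)`; in characteristic zero this is 1 only when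
  -- the row degrees agree.
  have hM : (2 : k) ^ (p + q) • act 2 M (mon k i j p q) = (2 : k) ^ (i + j) • mon k i j p q := by
    have hC : (C (2 : k) * C (2⁻¹ : k) : Poly k 2 2) = 1 := by
      rw [← C_mul, mul_inv_cancel₀ h2, C_1]
    have h0 : (C (2 : k) * C (2⁻¹ : k) : Poly k 2 2) ^ (p + q) = 1 := by rw [hC, one_pow]
    have hX (r j : Fin 2) : act 2 M (X (r, j)) = C (if r = 0 then 2 else 2⁻¹) * X (r, j) := by
      rw [act_X_two]
      fin_cases r <;> simp [M]
    simp only [mon, map_mul, map_pow, hX, smul_eq_C_mul, mul_pow, if_pos, one_ne_zero, if_false]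
      at h0 ⊢
    linear_combination (C 2 ^ (i + j) * (X (0, 0) ^ i * X (0, 1) ^ j * X (1, 0) ^ p * X (1, 1) ^ q))
      * h0
  have hRM := congrArg R hM
  rw [map_smul, map_smul, hR.equivariant, ← sub_eq_zero, ← sub_smul] at hRM
  refine (smul_eq_zero.1 hRM).resolve_left fun h0 => h ?_
  have : (2 : ℕ) ^ (p + q) = 2 ^ (i + j) := by exact_mod_cast sub_eq_zero.1 h0
  exact (Nat.pow_right_injective le_rfl this).symm

lemma map_mon_eq_zero {i j p q : ℕ} (h : ¬(i = q ∧ j = p)) : R (mon k i j p q) = 0 := by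
  by_cases h1 : i < q
  · exact map_mon_eq_zero_of_lt_right hR h1
  by_cases h2 : j < p
  · exact map_mon_eq_zero_of_lt_left hR h2
  -- Now `q ≤ i` and `p ≤ j`, not both equalities, so the row degrees differ.
  exact map_mon_eq_zero_of_unbalanced hR (by omega)

lemma map_mon_eq_smul (n m : ℕ) :
    R (mon k n m m n) =
      ((-1) ^ m * ((n.factorial : k) * m.factorial / (n + m).factorial)) •
        R (mon k (n + m) 0 0 (n + m)) := by
  induction m generalizing n with
  | zero => simp [Nat.cast_ne_zero.2 n.factorial_ne_zero]
  | succ m ih =>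
    -- Trading one `a₁b₂` for `a₂b₁` costs the factor `-(m+1)/(n+1)`.
    have h := relation hR (n + 1) (m + 1) m n
    have hn : ((n : k) + 1) ≠ 0 := Nat.cast_add_one_ne_zero n
    have hf : (((n + (m + 1)).factorial : ℕ) : k) ≠ 0 := Nat.cast_ne_zero.2 (Nat.factorial_ne_zero _)
    rw [Nat.add_sub_cancel, Nat.add_sub_cancel, ih, show n + 1 + m = n + (m + 1) by ring,
      smul_smul] at h
    have h' : ((n + 1 : ℕ) : k) • R (mon k n (m + 1) (m + 1) n) = ((n + 1 : ℕ) : k) •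
        (((-1) ^ (m + 1) * ((n.factorial : k) * (m + 1).factorial / (n + (m + 1)).factorial)) •
        R (mon k (n + (m + 1)) 0 0 (n + (m + 1)))) := by
      rw [eq_neg_of_add_eq_zero_left h, smul_smul, ← neg_smul]
      congr 1
      rw [Nat.factorial_succ n, Nat.factorial_succ m]
      push_cast
      ring
    exact smul_right_injective _ (Nat.cast_ne_zero.2 n.succ_ne_zero) h'

/-- In the binomial expansion of `Δ^d`, sign and binomial coefficient cancel the scalar of
`map_mon_eq_smul`, so all `d + 1` terms have the same image. -/
lemma smul_map_mon_eq_delta_pow (d : ℕ) :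
    (((d : k) + 1) • R (mon k d 0 0 d) : invariants k 2 2) = (Δ k 0 1 ^ d : Poly k 2 2) := by
  have h := congrArg Subtype.val
    (hR.splits ⟨Δ k 0 1 ^ d, pow_mem (delta_mem_invariants 0 1) d⟩)
  have hsum : (Δ k 0 1 ^ d : Poly k 2 2) = ∑ m ∈ Finset.range (d + 1),
      ((-1) ^ m * (d.choose m : k)) • mon k (d - m) m m (d - m) := by
    rw [show (Δ k 0 1 : Poly k 2 2) = -(a k 1 * b k 0) + a k 0 * b k 1 by rw [Δ]; ring, add_pow]
    refine Finset.sum_congr rfl fun m _ => ?_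
    rw [mon_eq_mul_pow, smul_eq_C_mul, neg_pow (a k 1 * b k 0)]
    simp only [map_mul, map_pow, map_neg, map_one, map_natCast]
    ring
  have hR' : R (Δ k 0 1 ^ d) = ((d : k) + 1) • R (mon k d 0 0 d) := by
    rw [hsum, map_sum, Finset.sum_congr rfl (g := fun _ => R (mon k d 0 0 d))]
    · simp [← Nat.cast_smul_eq_nsmul k]
    · intro m hm
      have hm : m ≤ d := Nat.lt_succ_iff.1 (Finset.mem_range.1 hm)
      rw [map_smul, map_mon_eq_smul hR, Nat.sub_add_cancel hm, smul_smul]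
      convert one_smul k _ using 2
      have hf (x : ℕ) : (x.factorial : k) ≠ 0 := Nat.cast_ne_zero.2 x.factorial_ne_zero
      rw [Nat.cast_choose k hm]
      field_simp [hf]
      rw [← pow_mul, mul_comm, pow_mul]; simp
  rw [← hR']
  exact h

lemma map_mon_eq_delta (n m : ℕ) :
    (R (mon k n m m n) : Poly k 2 2) =
      (((n.factorial : k) * (m.factorial : k)) / ((n + m + 1).factorial : k)) •
        (Δ k 0 1 ^ n * Δ k 1 0 ^ m) := by
  have h1 : (((n + m : ℕ) : k) + 1) ≠ 0 := Nat.cast_add_one_ne_zero _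
  have h2 : (((n + m).factorial : ℕ) : k) ≠ 0 := Nat.cast_ne_zero.2 (Nat.factorial_ne_zero _)
  have h3 := smul_map_mon_eq_delta_pow hR (n + m)
  have h4 : (Δ k 1 0 : Poly k 2 2) = -Δ k 0 1 := by simp only [Δ]; ring
  rw [h4, neg_pow, mul_left_comm, ← pow_add, ← h3, map_mon_eq_smul hR, Subalgebra.coe_smul,
    Subalgebra.coe_smul, show ((-1 : Poly k 2 2) ^ m) = C ((-1) ^ m) by simp, ← smul_eq_C_mul,
    smul_smul, smul_smul, Nat.factorial_succ (n + m)]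
  congr 1
  push_cast at h1 ⊢
  field_simp

end Relations

lemma IsReynolds.eq [CharZero k] {R S : Poly k 2 2 →ₗ[k] invariants k 2 2} (hR : IsReynolds R)
    (hS : IsReynolds S) : R = S := by
  refine (basisMonomials _ k).ext fun s => ?_
  simp only [coe_basisMonomials, monomial_eq_mon]
  by_cases h : s (0, 0) = s (1, 1) ∧ s (0, 1) = s (1, 0)
  · refine Subtype.ext ?_
    rw [← h.1, ← h.2, map_mon_eq_delta hR, map_mon_eq_delta hS]
  · rw [map_mon_eq_zero hR h, map_mon_eq_zero hS h]

end ReynoldsSL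
end

theorem theorem7p1 (k : Type*) [Field k] [CharZero k] :
    -- the invariant ring is generated by the size 2 minors
    ReynoldsSL.invariants k 2 2 =
      Algebra.adjoin k {f | ∃ i j : Fin 2, f = ReynoldsSL.Δ k i j} ∧
    -- there is exactly one Reynolds operator
    (∃! R : ReynoldsSL.Poly k 2 2 →ₗ[k] ReynoldsSL.invariants k 2 2, ReynoldsSL.IsReynolds R) ∧
    ∀ R : ReynoldsSL.Poly k 2 2 →ₗ[k] ReynoldsSL.invariants k 2 2, ReynoldsSL.IsReynolds R →
      (∀ n m : ℕ,
        (R ((ReynoldsSL.a k 0 * ReynoldsSL.b k 1) ^ n *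
            (ReynoldsSL.a k 1 * ReynoldsSL.b k 0) ^ m) : ReynoldsSL.Poly k 2 2) =
          (((n.factorial : k) * (m.factorial : k)) / ((n + m + 1).factorial : k)) •
            (ReynoldsSL.Δ k 0 1 ^ n * ReynoldsSL.Δ k 1 0 ^ m)) ∧
      (∀ n : ℕ,
        (R ((ReynoldsSL.a k 0 * ReynoldsSL.b k 1) ^ n) : ReynoldsSL.Poly k 2 2) =
          (1 / ((n : k) + 1)) • ReynoldsSL.Δ k 0 1 ^ n) ∧
      (∀ s : Fin 2 × Fin 2 →₀ ℕ,
        (¬ ∃ n m : ℕ, MvPolynomial.monomial s (1 : k) =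
          (ReynoldsSL.a k 0 * ReynoldsSL.b k 1) ^ n *
            (ReynoldsSL.a k 1 * ReynoldsSL.b k 0) ^ m) →
        R (MvPolynomial.monomial s (1 : k)) = 0) := by
  refine ⟨ReynoldsSL.invariants_eq_adjoin, ⟨ReynoldsSL.reynolds k,
    ReynoldsSL.isReynolds_reynolds, fun R hR => hR.eq ReynoldsSL.isReynolds_reynolds⟩,
    fun R hR => ?_⟩
  have hnm (n m : ℕ) := ReynoldsSL.map_mon_eq_delta hR n m
  simp only [ReynoldsSL.mon_eq_mul_pow] at hnm
  refine ⟨hnm, fun n => ?_, fun s hs => ?_⟩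
  · have hn : (n.factorial : k) ≠ 0 := Nat.cast_ne_zero.2 n.factorial_ne_zero
    have h1 : (n : k) + 1 ≠ 0 := Nat.cast_add_one_ne_zero n
    have h := hnm n 0
    rw [pow_zero, pow_zero, mul_one, mul_one, add_zero, Nat.factorial_succ] at h
    rw [h]
    congr 1
    push_cast
    rw [Nat.factorial_zero]
    field_simp
    simp
  · rw [ReynoldsSL.monomial_eq_mon]
    refine ReynoldsSL.map_mon_eq_zero hR fun h => hs ⟨s (0, 0), s (0, 1), ?_⟩
    rw [ReynoldsSL.monomial_eq_mon, ← h.1, ← h.2, ReynoldsSL.mon_eq_mul_pow]
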